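/- Trees and contexts. Let $\Sigma,\Delta$ be ranked alphabets (finite sets of symbols with ranks). $T_\Sigma$ is the set of trees over $\Sigma$; $T_\Sigma(Y)$ is the set of trees over $\Sigma$ that may in addition have elements of $Y$ as leaves. A context is a tree $C\in T_\Sigma(\{\bot\})$ with exactly one occurrence of $\bot$, and $C[y]$ is obtained from $C$ by replacing $\bot$ by the leaf $y$. For a node $v$ of $t$, $t/v$ is the subtree of $t$ at $v$. The largest common prefix $t\sqcap t'$ of two trees is defined by $t\sqcap t'=a(t_1\sqcap t'_1,\dots,t_k\sqcap t'_k)$ if $t=a(t_1,\dots,t_k)$ and $t'=a(t'_1,\dots,t'_k)$ have the same root label (leaf labels from $Y$ being regarded as symbols of rank $0$), and $t\sqcap t'=\bot$ otherwise. Transducers. A deterministic top-down tree transducer with regular look-ahead (dtla) $M$ from $\Sigma$ to $\Delta$ consists of a finite set $Q$ of states; a total deterministic bottom-up tree automaton over $\Sigma$ with finite state set $P$ (the look-ahead states), which assigns a state $\delta(s)\in P$ to every $s\in T_\Sigma$; an axiom $A(p)\in T_\Delta(\{q(x_0)\mid q\in Q\})$ for every $p\in P$; and a set of rules $q(a(x_1{:}p_1,\dots,x_k{:}p_k))\to\zeta$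 with $q\in Q$, $a\in\Sigma$ of rank $k$, $p_1,\dots,p_k\in P$ and $\zeta\in T_\Delta(\{q'(x_i)\mid q'\in Q,\,1\le i\le k\})$, with at most one rule for each left-hand side. As usual, every look-ahead state is assumed to be reachable: for each $p\in P$ there is $s\in T_\Sigma$ with $\delta(s)=p$. The rules define partial functions $q_M$ on $T_\Sigma$ by $q_M(a(s_1,\dots,s_k))=\zeta[q'(x_i)\leftarrow q'_M(s_i)]$, where $\zeta$ is the right-hand side for $q,a,\delta(s_1),\dots,\delta(s_k)$, and $M$ realizes the partial translation $[\![M]\!]:T_\Sigma\to T_\Delta$ given by $[\![M]\!](s)=A(\delta(s))[q(x_0)\leftarrow q_M(s)]$. $M$ is total if $[\![M]\!]$ is a total function; two dtlas are equivalent if they realize the same translation; a dtop is a dtla with exactly one look-ahead state. Difference trees. Extend $M$ to input trees in $T_\Sigma(P)$ by letting a leaf $p\in P$ have look-ahead state $p$ and letting every state $q$ translate the leaf $p$ into the output leaf $\langle q,p\rangle$. For a context $C$ and $p\in P$, write $M(C[p])\in T_\Delta(Q\times P)$ for the resulting output tree. The set of difference trees of $M$ is $$\mathrm{diff}(M)=\{M(C[p])/v\mid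 C\text{ a context},\ p,p'\in P,\ v\text{ a node of } M(C[p])\sqcap M(C[p'])\text{ with label }\bot\}.$$ Statement. Let $M$ be a total dtla. If $M$ is equivalent to a dtop, then $\mathrm{diff}(M)$ is finite. -/

import Mathlib

universe u v w x w' x'

namespace TreeTransducer

/-- A ranked alphabet: a finite set of symbols, each with a rank. -/
structure RankedAlphabet where
  Sym : Type u
  finite_sym : Finite Sym
  rank : Sym → ℕ

/-- `RTree A Y` is the set `T_A(Y)` of trees over the ranked alphabet `A` in which the elements
of `Y` are used as additional symbols of rank `0`. -/
inductive RTree (A : RankedAlphabet.{u}) (Y : Type v) : Type (max u v) where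
  | leaf (y : Y) : RTree A Y
  | node (a : A.Sym) (ts : Fin (A.rank a) → RTree A Y) : RTree A Y

/-- `T_A`, the trees over the ranked alphabet `A`. -/
abbrev GroundTree (A : RankedAlphabet.{u}) : Type u := RTree A Empty

/-- A finite family of possibly undefined values is defined iff all its members are. -/
def sequenceFin {α : Type*} {n : ℕ} (f : Fin n → Option α) : Option (Fin n → α) :=
  if h : ∀ i, (f i).isSome = true then some (fun i => (f i).get (h i)) else none

namespace RTree

variable {A : RankedAlphabet.{u}} {Y Z : Type*}

/-- Replace every leaf `y` of `Y` by the leaf `f y`. -/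
def map (f : Y → Z) : RTree A Y → RTree A Z
  | leaf y => leaf (f y)
  | node a ts => node a (fun i => (ts i).map f)

/-- Replace every leaf `y` of `Y` by the tree `f y`; the result is defined iff `f y` is defined
for every `y` that occurs in the tree. -/
def subst (f : Y → Option (RTree A Z)) : RTree A Y → Option (RTree A Z)
  | leaf y => f y
  | node a ts => (sequenceFin (fun i => (ts i).subst f)).map (node a)

/-- The number of occurrences of elements of `Y` in a tree. -/
def leafCount : RTree A Y → ℕ
  | leaf _ => 1
  | node _ ts => ∑ i, (ts i).leafCount

/-- The subtree `t/v` of `t` at the node `v`, undefined if `v` is not a node of `t`. A node is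
given by its path from the root; the children of a node are numbered from `0`. -/
def subtreeAt : List ℕ → RTree A Y → Option (RTree A Y)
  | [], t => some t
  | _ :: _, leaf _ => none
  | i :: v, node a ts => if h : i < A.rank a then subtreeAt v (ts ⟨i, h⟩) else none

open Classical in
/-- The largest common prefix `t ⊓ t'` of two trees. Its leaves are in `Y ∪ {⊥}`, where `⊥` is
`none`. -/
noncomputable def lcp : RTree A Y → RTree A Y → RTree A (Option Y)
  | leaf y, leaf z => if y = z then leaf (some y) else leaf none
  | leaf _, node _ _ => leaf none
  | node _ _, leaf _ => leaf none
  | node a ts, node b us =>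
      if h : a = b then
        node a (fun i => lcp (ts i) (us (Fin.cast (congrArg A.rank h) i)))
      else leaf none

/-- `v` is a difference node of `t` and `t'`: it is a node of `t ⊓ t'` with label `⊥`. -/
def IsDifferenceNode (t t' : RTree A Y) (v : List ℕ) : Prop :=
  (t.lcp t').subtreeAt v = some (leaf none)

/-- A context is a tree in `T_A({⊥})` with exactly one occurrence of `⊥`. -/
def IsContext (C : RTree A Unit) : Prop := C.leafCount = 1

/-- `C[y]`: the leaf `⊥` of the context `C` is replaced by the leaf `y`. -/
def plug (C : RTree A Unit) (y : Y) : RTree A Y := C.map (fun _ => y)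

end RTree

/-- A deterministic top-down tree transducer with regular look-ahead (dtla), with input alphabet
`S` and output alphabet `D`. -/
structure Dtla (S D : RankedAlphabet.{u}) where
  /-- the states -/
  Q : Type w
  /-- the look-ahead states -/
  P : Type x
  finite_Q : Finite Q
  finite_P : Finite P
  /-- the transitions of the look-ahead automaton, a total deterministic bottom-up automaton -/
  delta : (a : S.Sym) → (Fin (S.rank a) → P) → P
  /-- the axioms: `axm p` is a tree over `D` whose additional leaves `q` stand for `q(x₀)` -/
  axm : P → RTree D Q
  /-- the rules: `rhs q a p` is the right-hand side of the (at most one) rule with left-hand side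
  `q(a(x₁:p₁,…,xₖ:pₖ))`; a leaf `(q', i)` stands for the call `q'(xᵢ)` -/
  rhs : Q → (a : S.Sym) → (p : Fin (S.rank a) → P) → Option (RTree D (Q × Fin (S.rank a)))

namespace Dtla

variable {S D : RankedAlphabet.{u}} (M : Dtla.{u, w, x} S D) {Y Z : Type*}

/-- The look-ahead state at the root of an input tree whose additional leaves `y` have look-ahead
state `la y`. -/
def lookAhead (la : Y → M.P) : RTree S Y → M.P
  | .leaf y => la y
  | .node a ts => M.delta a (fun i => lookAhead la (ts i))

/-- The translation of an input tree starting in a given state, where the additional input leaves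
`y` have look-ahead state `la y` and are translated by the state `q` into the leaf `out q y`.
It is undefined if a needed rule is missing. -/
def stateTrans (la : Y → M.P) (out : M.Q → Y → Z) : RTree S Y → M.Q → Option (RTree D Z)
  | .leaf y, q => some (.leaf (out q y))
  | .node a ts, q =>
      (M.rhs q a (fun i => M.lookAhead la (ts i))).bind
        (fun ζ => ζ.subst (fun c => stateTrans la out (ts c.2) c.1))

/-- The translation of an input tree, starting with the axiom of its look-ahead state. -/
def trans (la : Y → M.P) (out : M.Q → Y → Z) (s : RTree S Y) : Option (RTree D Z) :=
  (M.axm (M.lookAhead la s)).subst (M.stateTrans la out s)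

/-- The state `δ_M(s)` of the look-ahead automaton for an input tree `s`. -/
def deltaTree (s : GroundTree S) : M.P := M.lookAhead Empty.elim s

/-- The partial translation `⟦M⟧` from input trees to output trees realized by `M`. -/
def sem (s : GroundTree S) : Option (GroundTree D) :=
  M.trans Empty.elim (fun _ => Empty.elim) s

/-- The extension of `M` to input trees in `T_S(P)`: a leaf `p` has look-ahead state `p`, and a
state `q` translates the leaf `p` into the output leaf `⟨q,p⟩`. -/
def semExt (s : RTree S M.P) : Option (RTree D (M.Q × M.P)) :=
  M.trans id (fun q p => (q, p)) s

/-- `M` is total: its translation is a total function. -/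
def IsTotal : Prop := ∀ s : GroundTree S, (M.sem s).isSome = true

/-- Every look-ahead state is the look-ahead state of some input tree. -/
def LookAheadReachable : Prop := ∀ p : M.P, ∃ s : GroundTree S, M.deltaTree s = p

/-- A deterministic top-down tree transducer (dtop) is a dtla with a single look-ahead state. -/
def IsDtop : Prop := Nat.card M.P = 1

/-- Two dtlas with the same alphabets are equivalent if they realize the same translation. -/
def Equivalent (M : Dtla.{u, w, x} S D) (N : Dtla.{u, w', x'} S D) : Prop := M.sem = N.sem

/-- The set `diff(M)` of difference trees of `M`: the subtrees `M(C[p])/v`, where `C` is a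
context, `p` and `p'` are look-ahead states and `v` is a difference node of `M(C[p])` and
`M(C[p'])`. -/
def diff : Set (RTree D (M.Q × M.P)) :=
  {d | ∃ (C : RTree S Unit) (p p' : M.P) (t t' : RTree D (M.Q × M.P)) (v : List ℕ),
    C.IsContext ∧ M.semExt (C.plug p) = some t ∧ M.semExt (C.plug p') = some t' ∧
      t.IsDifferenceNode t' v ∧ t.subtreeAt v = some d}

end Dtla
end TreeTransducer

/-! Fix a ground tree `g p` with look-ahead state `p` for each `p`, and let `n` bound the heights of
all defined translations of these finitely many trees by states of `M` and of the dtop `N`. Then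
`M(C[g p])` arises from `M(C[p])` by substituting trees of height at most `n`. As `N` has one
look-ahead state, its outputs on `C[g p]` and `C[g p']` arise from one tree `c`, again by
substituting trees of height at most `n`; by equivalence these are also the outputs of `M`. Let `v`
be a difference node of `M(C[p])` and `M(C[p'])`. If `v` is at or below a leaf of `c`, the output at
`v` is small. Otherwise both outputs have the same symbol at `v`, so one of the two prefixes has a
leaf there; this bounds the difference tree by `2n` (`height_subtreeAt_differenceNode_le`). Over
finite alphabets, bounded height means finitely many trees (`finite_height_le`). -/

namespace TreeTransducer

/-! ### Finite families of partial values. -/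

section SequenceFin

variable {α β : Type*} {n : ℕ}

theorem sequenceFin_eq_some_iff {f : Fin n → Option α} {g : Fin n → α} :
    sequenceFin f = some g ↔ ∀ i, f i = some (g i) := by
  unfold sequenceFin
  constructor
  · intro h i
    split at h
    · simp only [Option.some.injEq] at h
      simp [← h]
    · simp at h
  · intro h
    have h' : ∀ i, (f i).isSome = true := fun i => by simp [h i]
    rw [dif_pos h']
    congr 1
    funext i
    simp [h i]

theorem sequenceFin_bind (f : Fin n → Option α) (g : α → Option β) :
    sequenceFin (fun i => (f i).bind g) =
      (sequenceFin f).bind (fun x => sequenceFin (fun i => g (x i))) := by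
  ext y
  simp only [sequenceFin_eq_some_iff, Option.bind_eq_some_iff]
  constructor
  · intro h
    choose x hx using h
    exact ⟨x, fun i => (hx i).1, fun i => (hx i).2⟩
  · rintro ⟨x, hx, hy⟩ i
    exact ⟨x i, hx i, hy i⟩

end SequenceFin

/-! ### Substitution, height and difference nodes of trees. -/

namespace RTree

variable {A : RankedAlphabet.{u}} {Y Z W : Type*}

/-- Replace every leaf `y` of `Y` by the tree `g y`. -/
def bind (g : Y → RTree A Z) : RTree A Y → RTree A Z
  | leaf y => g y
  | node a ts => node a (fun i => (ts i).bind g)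

theorem bind_map (f : Y → Z) (g : Z → RTree A W) (t : RTree A Y) :
    (t.map f).bind g = t.bind (fun y => g (f y)) := by
  induction t with
  | leaf y => rfl
  | node a ts ih => simp only [map, bind, ih]

/-- Both sides fail as soon as one occurring leaf fails, so no definedness hypothesis is needed. -/
theorem subst_subst (f : Y → Option (RTree A Z)) (g : Z → Option (RTree A W)) (t : RTree A Y) :
    (t.subst f).bind (subst g) = t.subst (fun y => (f y).bind (subst g)) := by
  induction t with
  | leaf y => rfl
  | node a ts ih =>
    simp only [subst, ← ih, sequenceFin_bind, Option.bind_map, Option.map_bind]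
    rfl

theorem subst_node_eq_some {f : Y → Option (RTree A Z)} {a : A.Sym}
    {ts : Fin (A.rank a) → RTree A Y} {r : RTree A Z} (h : (node a ts).subst f = some r) :
    ∃ rs, r = node a rs ∧ ∀ i, (ts i).subst f = some (rs i) := by
  simp only [subst, Option.map_eq_some_iff, sequenceFin_eq_some_iff] at h
  obtain ⟨rs, h, rfl⟩ := h
  exact ⟨rs, rfl, h⟩

/-- The height of a tree; leaves have height `0`. -/
def height : RTree A Y → ℕ
  | leaf _ => 0
  | node _ ts => Finset.univ.sup (fun i => (ts i).height) + 1

theorem height_node_le_succ {a : A.Sym} {ts : Fin (A.rank a) → RTree A Y} {n : ℕ} :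
    (node a ts).height ≤ n + 1 ↔ ∀ i, (ts i).height ≤ n := by
  simp [height]

theorem height_child_lt {a : A.Sym} (ts : Fin (A.rank a) → RTree A Y) (i : Fin (A.rank a)) :
    (ts i).height < (node a ts).height :=
  Nat.lt_succ_of_le (Finset.le_sup (f := fun i => (ts i).height) (Finset.mem_univ i))

theorem finite_height_le [Finite Y] (n : ℕ) : {t : RTree A Y | t.height ≤ n}.Finite := by
  have := A.finite_sym
  induction n with
  | zero =>
    refine (Set.finite_range (leaf : Y → RTree A Y)).subset ?_
    rintro (y | ⟨a, ts⟩) h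
    · exact ⟨y, rfl⟩
    · simp [height] at h
  | succ n ih =>
    refine ((Set.finite_range (leaf : Y → RTree A Y)).union
      (Set.finite_iUnion fun a => (Set.Finite.pi' fun _ => ih).image (node a))).subset ?_
    rintro (y | ⟨a, ts⟩) h
    · exact Or.inl ⟨y, rfl⟩
    · exact Or.inr (Set.mem_iUnion.2 ⟨a, ts, height_node_le_succ.1 h, rfl⟩)

theorem height_le_of_subst {f : Y → Option (RTree A Z)} {t : RTree A Y} {r : RTree A Z}
    (h : t.subst f = some r) : t.height ≤ r.height := by
  induction t generalizing r with
  | leaf y => exact Nat.zero_le _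
  | node a ts ih =>
    obtain ⟨rs, rfl, hrs⟩ := subst_node_eq_some h
    exact height_node_le_succ.2 fun i =>
      (ih i (hrs i)).trans (Nat.le_of_lt_succ (height_child_lt rs i))

theorem height_subst_le {f : Y → Option (RTree A Z)} {n : ℕ}
    (hf : ∀ y u, f y = some u → u.height ≤ n) {t : RTree A Y} {r : RTree A Z}
    (h : t.subst f = some r) : r.height ≤ t.height + n := by
  induction t generalizing r with
  | leaf y => exact (hf y r h).trans (Nat.le_add_left _ _)
  | node a ts ih =>
    obtain ⟨rs, rfl, hrs⟩ := subst_node_eq_some h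
    have hle : ∀ i, (rs i).height ≤ Finset.univ.sup (fun i => (ts i).height) + n := fun i =>
      (ih i (hrs i)).trans (Nat.add_le_add_right
        (Finset.le_sup (f := fun i => (ts i).height) (Finset.mem_univ i)) n)
    exact (height_node_le_succ.2 hle).trans_eq (Nat.add_right_comm _ _ _)

theorem height_subtreeAt_le {v : List ℕ} {t d : RTree A Y} (h : t.subtreeAt v = some d) :
    d.height ≤ t.height := by
  induction v generalizing t with
  | nil =>
    simp only [subtreeAt, Option.some.injEq] at h
    rw [h]
  | cons i v ih =>
    cases t with
    | leaf y => simp [subtreeAt] at h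
    | node a ts =>
      simp only [subtreeAt] at h
      split at h
      · exact (ih h).trans (height_child_lt ts _).le
      · simp at h

/-- If the results of substituting small trees into `t` and `t'` have a common prefix `c` that
covers them up to small trees, then the subtrees of `t` at the difference nodes of `t` and `t'`
are small. -/
theorem height_subtreeAt_differenceNode_le {f : Y → Option (RTree A Z)}
    {g g' : W → Option (RTree A Z)} {n : ℕ} (hf : ∀ y u, f y = some u → u.height ≤ n)
    (hg : ∀ y u, g y = some u → u.height ≤ n)
    {v : List ℕ} {t t' d : RTree A Y} {c : RTree A W} {r r' : RTree A Z}
    (ht : t.subst f = some r) (ht' : t'.subst f = some r')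
    (hc : c.subst g = some r) (hc' : c.subst g' = some r')
    (hv : t.IsDifferenceNode t' v) (hd : t.subtreeAt v = some d) : d.height ≤ n + n := by
  induction v generalizing t t' c r r' with
  | nil =>
    simp only [subtreeAt, Option.some.injEq] at hd
    subst hd
    cases c with
    -- The node is a leaf of `c`, so all of `r` is a substituted tree.
    | leaf w => exact (height_le_of_subst ht).trans ((hg w r hc).trans (Nat.le_add_left _ _))
    | node a cs =>
      cases t with
      | leaf y => exact Nat.zero_le _
      | node b ts =>
        cases t' with
        | leaf y' =>
          -- Here `r'` is a substituted tree containing `c` as a prefix, so `c` has height at most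
          -- `n`; substituting into `c` adds at most `n` more, whence the bound `n + n`.
          have h₁ : (node a cs).height ≤ n := (height_le_of_subst hc').trans (hf y' r' ht')
          exact (height_le_of_subst ht).trans
            ((height_subst_le hg hc).trans (Nat.add_le_add_right h₁ n))
        | node b' ts' =>
          obtain ⟨rs, rfl, -⟩ := subst_node_eq_some hc
          obtain ⟨rs', rfl, -⟩ := subst_node_eq_some hc'
          obtain ⟨us, hu, -⟩ := subst_node_eq_some ht
          obtain ⟨us', hu', -⟩ := subst_node_eq_some ht'
          cases hu
          cases hu'
          -- Both roots carry the root symbol of `c`, so the common prefix is not `⊥` here.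
          simp [IsDifferenceNode, lcp, subtreeAt] at hv
  | cons i v ih =>
    cases c with
    | leaf w =>
      exact (height_subtreeAt_le hd).trans
        ((height_le_of_subst ht).trans ((hg w r hc).trans (Nat.le_add_left _ _)))
    | node a cs =>
      cases t with
      | leaf y => simp [subtreeAt] at hd
      | node b ts =>
        cases t' with
        | leaf y' => simp [IsDifferenceNode, lcp, subtreeAt] at hv
        | node b' ts' =>
          obtain ⟨rs, rfl, hcs⟩ := subst_node_eq_some hc
          obtain ⟨rs', rfl, hcs'⟩ := subst_node_eq_some hc'
          obtain ⟨us, hu, hts⟩ := subst_node_eq_some ht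
          obtain ⟨us', hu', hts'⟩ := subst_node_eq_some ht'
          cases hu
          cases hu'
          simp only [IsDifferenceNode, lcp, subtreeAt, dite_true] at hv hd
          split at hd
          · rename_i hi
            rw [dif_pos hi] at hv
            exact ih (hts ⟨i, hi⟩) (hts' ⟨i, hi⟩) (hcs ⟨i, hi⟩) (hcs' ⟨i, hi⟩) hv hd
          · simp at hd

end RTree

/-! ### Translations of substituted input trees, and the height bound. -/

namespace Dtla

variable {S D : RankedAlphabet.{u}} (M : Dtla.{u, w, x} S D) {Y Z : Type*}

/-- The translation of a ground input tree starting in a given state. -/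
def stateSem (q : M.Q) (s : GroundTree S) : Option (GroundTree D) :=
  M.stateTrans Empty.elim (fun _ => Empty.elim) s q

theorem deltaTree_bind {la : Y → M.P} {g : Y → GroundTree S}
    (hla : ∀ y, M.deltaTree (g y) = la y) (s : RTree S Y) :
    M.deltaTree (s.bind g) = M.lookAhead la s := by
  unfold deltaTree at *
  induction s with
  | leaf y => exact hla y
  | node a ts ih => simp only [RTree.bind, lookAhead, ih]

theorem stateSem_bind {la : Y → M.P} {g : Y → GroundTree S} {out : M.Q → Y → Z}
    {σ : Z → Option (GroundTree D)} (hla : ∀ y, M.deltaTree (g y) = la y)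
    (hσ : ∀ q y, σ (out q y) = M.stateSem q (g y)) (s : RTree S Y) (q : M.Q) :
    M.stateSem q (s.bind g) = (M.stateTrans la out s q).bind (RTree.subst σ) := by
  induction s generalizing q with
  | leaf y => exact (hσ q y).symm
  | node a ts ih =>
    have hl : ∀ i, M.lookAhead Empty.elim ((ts i).bind g) = M.lookAhead la (ts i) :=
      fun i => M.deltaTree_bind hla (ts i)
    unfold stateSem at ih
    simp only [stateSem, RTree.bind, stateTrans, hl, ih, Option.bind_assoc, RTree.subst_subst]

/-- Processing a tree before or after its leaves are filled in gives the same output. It serves both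
for `M`, with output leaves `⟨q,p⟩`, and for the dtop, with output leaves `q` that forget the input
leaf. -/
theorem sem_bind {la : Y → M.P} {g : Y → GroundTree S} {out : M.Q → Y → Z}
    {σ : Z → Option (GroundTree D)} (hla : ∀ y, M.deltaTree (g y) = la y)
    (hσ : ∀ q y, σ (out q y) = M.stateSem q (g y)) (s : RTree S Y) :
    M.sem (s.bind g) = (M.trans la out s).bind (RTree.subst σ) := by
  have hl : M.lookAhead Empty.elim (s.bind g) = M.lookAhead la s := M.deltaTree_bind hla s
  have hs : ∀ q, M.stateTrans Empty.elim (fun _ => Empty.elim) (s.bind g) q =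
      (M.stateTrans la out s q).bind (RTree.subst σ) := M.stateSem_bind hla hσ s
  simp only [sem, trans, hl, RTree.subst_subst, ← hs]

theorem exists_height_stateSem_le {ι : Type*} [Finite ι] (g : ι → GroundTree S) :
    ∃ n : ℕ, ∀ q i u, M.stateSem q (g i) = some u → u.height ≤ n := by
  have := M.finite_Q
  obtain ⟨n, hn⟩ := (Set.finite_range
    -- Undefined translations get the harmless height `0`.
    fun c : M.Q × ι => ((M.stateSem c.1 (g c.2)).map RTree.height).getD 0).bddAbove
  exact ⟨n, fun q i u hu => hn ⟨(q, i), by simp [hu]⟩⟩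

/-- The difference trees of a total dtla that is equivalent to a dtop have bounded height. -/
theorem exists_height_diff_le {M : Dtla.{u, w, x} S D} {N : Dtla.{u, w', x'} S D}
    (hreach : M.LookAheadReachable) (htotal : M.IsTotal) (hN : N.IsDtop) (hMN : M.Equivalent N) :
    ∃ n : ℕ, ∀ d ∈ M.diff, d.height ≤ n := by
  have := M.finite_P
  obtain ⟨hsub, ⟨e⟩⟩ := Nat.card_eq_one_iff_unique.1 hN
  choose g hg using hreach
  obtain ⟨m, hm⟩ := M.exists_height_stateSem_le g
  obtain ⟨k, hk⟩ := N.exists_height_stateSem_le g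
  refine ⟨max m k + max m k, ?_⟩
  rintro d ⟨C, p, p', t, t', v, -, ht, ht', hv, hd⟩
  have hM : ∀ p t, M.semExt (C.plug p) = some t →
      t.subst (fun c => M.stateSem c.1 (g c.2)) = M.sem (C.bind fun _ => g p) := by
    intro p t ht
    have h := M.sem_bind (g := g) (la := id) (out := fun q p => (q, p))
      (σ := fun c => M.stateSem c.1 (g c.2)) hg (fun _ _ => rfl) (C.plug p)
    rw [RTree.plug, RTree.bind_map] at h
    rw [h]
    exact (congrArg (Option.bind · _) ht).symm
  -- The inner tree `N.trans … C` does not depend on `p`: the only look-ahead state `e` is that of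
  -- every `g p`.
  have hS : ∀ p, M.sem (C.bind fun _ => g p) =
      (N.trans (fun _ => e) (fun q _ => q) C).bind (RTree.subst fun q => N.stateSem q (g p)) :=
    fun p => (congrFun hMN _).trans
      (N.sem_bind (fun _ => Subsingleton.elim _ _) (fun _ _ => rfl) C)
  obtain ⟨r, hr⟩ := Option.isSome_iff_exists.1 (htotal (C.bind fun _ => g p))
  obtain ⟨r', hr'⟩ := Option.isSome_iff_exists.1 (htotal (C.bind fun _ => g p'))
  obtain ⟨c, hc, hcr⟩ := Option.bind_eq_some_iff.1 ((hS p).symm.trans hr)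
  obtain ⟨c', hc', hcr'⟩ := Option.bind_eq_some_iff.1 ((hS p').symm.trans hr')
  -- This is the common prefix shared by the two outputs.
  obtain rfl : c = c' := Option.some.inj (hc.symm.trans hc')
  exact RTree.height_subtreeAt_differenceNode_le
    (fun y u hu => (hm y.1 y.2 u hu).trans (le_max_left _ _))
    (fun q u hu => (hk q p u hu).trans (le_max_right _ _))
    ((hM p t ht).trans hr) ((hM p' t' ht').trans hr') hcr hcr' hv hd

end Dtla
end TreeTransducer

theorem mainTheorem2 {S D : TreeTransducer.RankedAlphabet.{u}}
    (M : TreeTransducer.Dtla.{u, w, x} S D)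
    (hreach : M.LookAheadReachable) (htotal : M.IsTotal)
    (hdtop : ∃ N : TreeTransducer.Dtla.{u, w', x'} S D, N.IsDtop ∧ M.Equivalent N) :
    M.diff.Finite := by
  obtain ⟨N, hN, hMN⟩ := hdtop
  have := M.finite_Q
  have := M.finite_P
  obtain ⟨n, hn⟩ := TreeTransducer.Dtla.exists_height_diff_le hreach htotal hN hMN
  exact (TreeTransducer.RTree.finite_height_le n).subset hn
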